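/- **Proposition 4.1 ($H_G$ for chordal graphs).** Let $G$ be a chordal graph on a finite vertex set $V$ (every cycle of length at least $4$ has a chord), and let $E$ be the set of edges of $G$ together with all self-loops $\{i,i\}$, $i\in V$. Let $\mathcal{C}_G\subset\mathbb{R}^E$ be the cone of all partial symmetric matrices $T=(T_{ij})_{\{i,j\}\in E}$ that can be completed to a positive definite real symmetric $V\times V$ matrix, and let $\partial\mathcal{C}_G=\overline{\mathcal{C}_G}\setminus\mathcal{C}_G$. Write $t_{ij}=t_{ji}$, $\{i,j\}\in E$, for the coordinates on $\mathbb{R}^E$, and for a clique $C$ of $G$ let $T_{CC}=(t_{ij})_{i,j\in C}$. Put $$H_G \;=\; \prod_{C \text{ maximal clique of } G}\det(T_{CC}).$$ Then $H_G$ is the defining polynomial of the Zariski closure of $\partial\mathcal{C}_G$. That is: for $k=\mathbb{R}$ and for $k=\mathbb{C}$, the ideal of all polynomials in $k[t_{ij}:\{i,j\}\in E]$ that vanish on $\partial\mathcal{C}_G$ is generated by $H_G$; and the Zariski closure, in the complex projective space $\mathbb{P}(\mathbb{C}^E)$, of the set of points represented by nonzero vectors of $\partial\mathcal{C}_G$ is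 the hypersurface $\{H_G=0\}$. -/

import Mathlib

open scoped LinearAlgebra.Projectivization

namespace SimpleGraph

/-- A graph is chordal if every cycle of length at least four has a chord: an edge of the graph
that joins two vertices of the cycle and is not an edge of the cycle. -/
def IsChordalGraph {V : Type*} (G : SimpleGraph V) : Prop :=
  ∀ (v : V) (p : G.Walk v v), p.IsCycle → 4 ≤ p.length →
    ∃ a ∈ p.support, ∃ b ∈ p.support, G.Adj a b ∧ s(a, b) ∉ p.edges

/-- The edges of `G` together with all self-loops: the specified positions `(i, j)` of a
partial symmetric matrix (positions `(i, j)` and `(j, i)` are identified). -/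
abbrev LoopEdge {V : Type*} (G : SimpleGraph V) : Type _ :=
  {e : Sym2 V // e.IsDiag ∨ e ∈ G.edgeSet}

/-- The cone of sufficient statistics `C_G`, that is, the image of the cone of real positive
definite matrices under the projection that keeps the entries in the positions of `G.LoopEdge`.
So it consists of the partial matrices `T` that can be completed to a positive definite matrix. -/
def sufficientStatisticsCone {V : Type*} (G : SimpleGraph V) : Set (G.LoopEdge → ℝ) :=
  {T | ∃ S : Matrix V V ℝ, S.PosDef ∧
    ∀ (i j : V) (h : s(i, j).IsDiag ∨ s(i, j) ∈ G.edgeSet), S i j = T ⟨s(i, j), h⟩}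

/-- The boundary `∂C_G`: the topological closure of `C_G` minus `C_G`. -/
def sufficientStatisticsBoundary {V : Type*} (G : SimpleGraph V) : Set (G.LoopEdge → ℝ) :=
  closure G.sufficientStatisticsCone \ G.sufficientStatisticsCone

open Classical in
/-- The generic partial symmetric matrix `T`: its entry in a specified position is the variable
of that position. The value `0` in the other positions is a placeholder; it does not occur in a
principal submatrix indexed by a clique. -/
noncomputable def genericPartialMatrix {V : Type*} (G : SimpleGraph V) (R : Type*) [CommRing R] :
    Matrix V V (MvPolynomial G.LoopEdge R) :=
  Matrix.of fun i j =>
    if h : s(i, j).IsDiag ∨ s(i, j) ∈ G.edgeSet then MvPolynomial.X ⟨s(i, j), h⟩ else 0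

open Classical in
/-- The product of the principal minors `det (T_CC)` of the generic partial matrix `T` over all
inclusion-maximal cliques `C` of `G`. -/
noncomputable def maximalCliqueMinorProduct {V : Type*} [Fintype V] (G : SimpleGraph V)
    (R : Type*) [CommRing R] : MvPolynomial G.LoopEdge R :=
  ∏ C : Finset V with Maximal G.IsClique (C : Set V),
    ((G.genericPartialMatrix R).submatrix (fun i : C => (i : V)) (fun j : C => (j : V))).det

end SimpleGraph

/-- The set of points of `ℂ^σ` whose coordinates are those of a real point of `A`. -/
def complexPoints {σ : Type*} (A : Set (σ → ℝ)) : Set (σ → ℂ) :=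
  (fun t e => (t e : ℂ)) '' A

/-- The points of the complex projective space `ℙ(ℂ^σ)` that are represented by a nonzero vector
of `A`. -/
def projectivePoints {σ : Type*} (A : Set (σ → ℂ)) : Set (ℙ ℂ (σ → ℂ)) :=
  {q | ∃ z ∈ A, ∃ hz : z ≠ 0, Projectivization.mk ℂ z hz = q}

/-- The zero set of a polynomial in complex projective space. (It is used for homogeneous
polynomials only; for these the choice of the representative does not matter.) -/
def projectiveZeroSet {σ : Type*} (f : MvPolynomial σ ℂ) : Set (ℙ ℂ (σ → ℂ)) :=
  {q | MvPolynomial.eval q.rep f = 0}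

/-- The Zariski closure of a subset of complex projective space: the set of common zeros of all
homogeneous polynomials that vanish on the subset. -/
def projectiveZariskiClosure {σ : Type*} (A : Set (ℙ ℂ (σ → ℂ))) : Set (ℙ ℂ (σ → ℂ)) :=
  {q | ∀ (n : ℕ) (f : MvPolynomial σ ℂ), f.IsHomogeneous n →
    A ⊆ projectiveZeroSet f → q ∈ projectiveZeroSet f}

/-! ### Simplicial vertices of chordal graphs -/

namespace SimpleGraph

variable {V : Type*} {G : SimpleGraph V}

/-! Clique blocks decide where the boundary is. For chordal `G`, positive definite clique blocks
suffice for a positive definite completion: remove a simplicial vertex (Dirac), complete the rest,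
and restore the vertex by a bordering whose Schur complement is the positive one already present in
the clique formed by the vertex and its remaining neighbours (`IsChordalGraph.exists_completion`).
At a boundary point the maximal clique blocks are positive semidefinite, being limits of positive
definite ones, and one of them is singular. Hence the product of minors vanishes on the boundary.

Conversely, let `f` vanish on the boundary and let `C` be a nonempty maximal clique. Some point has
a singular block at `C` and positive definite blocks at all cliques not containing `C`
(`IsClique.exists_partialMatrix`). The minor of `C` is linear in a diagonal variable, with leading
coefficient nonzero at this point, so its zero set is locally a graph over the other coordinates,
and near the point this graph lies in the boundary. The real boundary thus contains a piece of the
hypersurface of full dimension. Pseudo-division by the minor leaves a remainder that vanishes on an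
open set, and irreducibility of the generic symmetric determinant then shows that the minor divides
`f` (`IsChordalGraph.genericMinor_dvd`).

Minors of distinct maximal cliques are coprime, so their product divides `f`. All this works over
any field containing `ℝ`, which gives both ideals; homogeneity gives the projective statement. -/

/-- A walk with a chord can be shortened without leaving its support. -/
lemma Walk.exists_shorter_of_chord {u v a b : V} (p : G.Walk u v) (ha : a ∈ p.support)
    (hb : b ∈ p.support) (hab : G.Adj a b) (he : s(a, b) ∉ p.edges) :
    ∃ q : G.Walk u v, q.length < p.length ∧ ∀ w ∈ q.support, w ∈ p.support := by
  -- The part of the walk between the ends of the chord has length at least two, so replacing it by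
  -- the chord shortens the walk.
  have key : ∀ {a b : V} (r : G.Walk a b), G.Adj a b → s(a, b) ∉ r.edges → 2 ≤ r.length := by
    intro a b r hab he
    match r with
    | .nil => exact absurd hab (G.loopless.irrefl _)
    | .cons h .nil => simp at he
    | .cons h (.cons h' q) => simp
  obtain ⟨p₁, r, rfl⟩ := Walk.mem_support_iff_exists_append.1 ha
  rw [Walk.mem_support_append_iff] at hb
  rcases hb with hb | hb
  · obtain ⟨q₁, q₂, rfl⟩ := Walk.mem_support_iff_exists_append.1 hb
    have := key q₂ hab.symm (by
      rw [Sym2.eq_swap]; intro h; apply he; simp [Walk.edges_append, h])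
    refine ⟨q₁.append (.cons hab.symm r), ?_, ?_⟩
    · simp only [Walk.length_append, Walk.length_cons]; omega
    · intro w hw
      simp only [Walk.mem_support_append_iff, Walk.support_cons, List.mem_cons] at hw ⊢
      rcases hw with hw | rfl | hw
      · simp [hw]
      · simp
      · simp [hw]
  · obtain ⟨q₁, q₂, rfl⟩ := Walk.mem_support_iff_exists_append.1 hb
    have := key q₁ hab (by intro h; apply he; simp [Walk.edges_append, h])
    refine ⟨p₁.append (.cons hab q₂), ?_, ?_⟩
    · simp only [Walk.length_append, Walk.length_cons]; omega
    · intro w hw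
      simp only [Walk.mem_support_append_iff, Walk.support_cons, List.mem_cons] at hw ⊢
      rcases hw with hw | rfl | hw
      · simp [hw]
      · simp
      · simp [hw]

/-- In a chordal graph, two neighbours of `x` that are joined by a walk whose inner vertices avoid
the closed neighbourhood of `x` are adjacent. -/
lemma IsChordalGraph.adj_of_walk (hG : G.IsChordalGraph) {x u v : V} (hu : G.Adj x u)
    (hv : G.Adj x v) (huv : u ≠ v) (p : G.Walk u v)
    (hp : ∀ w ∈ p.support, w = u ∨ w = v ∨ (w ≠ x ∧ ¬ G.Adj x w)) : G.Adj u v := by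
  classical
  by_contra hnadj
  -- A shortest admissible walk is a path, and no chord can shorten it.
  let Q : ℕ → Prop := fun n => ∃ p : G.Walk u v, p.length = n ∧
    ∀ w ∈ p.support, w = u ∨ w = v ∨ (w ≠ x ∧ ¬ G.Adj x w)
  have hQ : ∃ n, Q n := ⟨_, p, rfl, hp⟩
  obtain ⟨p, hpl, hp⟩ := Nat.find_spec hQ
  have hmin : ∀ q : G.Walk u v, (∀ w ∈ q.support, w ∈ p.support) → p.length ≤ q.length := by
    intro q hq
    rw [hpl]
    exact Nat.find_min' hQ ⟨q, rfl, fun w hw => hp w (hq w hw)⟩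
  have hpath : p.IsPath := by
    have h := hmin p.bypass (fun w hw => p.support_bypass_subset_support hw)
    rw [← Walk.bypass_eq_self_of_length_le_length_bypass p h]
    exact p.bypass_isPath
  have hx : x ∉ p.support := fun h => by
    rcases hp x h with rfl | rfl | h
    · exact G.loopless.irrefl _ hu
    · exact G.loopless.irrefl _ hv
    · exact h.1 rfl
  have hlen : 2 ≤ p.length := by
    match p with
    | .nil => exact absurd rfl huv
    | .cons h .nil => exact absurd h hnadj
    | .cons h (.cons h' q) => simp
  -- Closing the path through `x` gives a cycle of length at least four. A chord at `x` would end at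
  -- an inner vertex, which is not a neighbour of `x`; any other chord would shorten the path.
  have hcyc : (Walk.cons hu (p.concat hv.symm)).IsCycle := by
    rw [Walk.cons_isCycle_iff]
    refine ⟨hpath.concat hx hv.symm, ?_⟩
    rw [Walk.edges_concat]
    simp only [List.concat_eq_append, List.mem_append, List.mem_singleton, not_or]
    refine ⟨fun h => hx (p.fst_mem_support_of_mem_edges h), ?_⟩
    rw [Sym2.eq_swap (a := v)]
    simp only [Sym2.congr_right]
    exact huv
  obtain ⟨a, ha, b, hb, hab, he⟩ := hG _ _ hcyc (by simp; omega)
  have hside : ∀ b, b ∈ p.support → G.Adj x b →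
      s(x, b) ∈ (Walk.cons hu (p.concat hv.symm)).edges := by
    intro b hb hxb
    rcases hp b hb with rfl | rfl | h
    · simp
    · simp [Walk.edges_concat, Sym2.eq_swap]
    · exact absurd hxb h.2
  have hsupp : ∀ c ∈ (Walk.cons hu (p.concat hv.symm)).support, c = x ∨ c ∈ p.support := by
    intro c hc
    simp only [Walk.support_cons, Walk.support_concat, List.mem_cons,
      List.mem_append, List.not_mem_nil, or_false] at hc
    tauto
  rcases hsupp a ha with rfl | ha'
  · rcases hsupp b hb with rfl | hb'
    · exact G.loopless.irrefl _ hab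
    · exact he (hside b hb' hab)
  · rcases hsupp b hb with rfl | hb'
    · exact he (Sym2.eq_swap ▸ hside a ha' hab.symm)
    · obtain ⟨q, hql, hq⟩ := p.exists_shorter_of_chord ha' hb' hab (fun h => he (by
        simp [Walk.edges_concat, h]))
      exact absurd (hmin q hq) (by omega)

/-- Dirac's lemma, relative to a vertex: in an induced subgraph of a chordal graph, if `x` has a
non-neighbour, then it has a simplicial one. -/
lemma IsChordalGraph.exists_simplicial_not_adj (hG : G.IsChordalGraph) (W : Finset V) :
    ∀ x ∈ W, ∀ y ∈ W, y ≠ x → ¬ G.Adj x y →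
      ∃ v ∈ W, v ≠ x ∧ ¬ G.Adj x v ∧ G.IsClique {w | w ∈ W ∧ G.Adj v w} := by
  classical
  induction W using Finset.strongInduction with
  | H W ih =>
  intro x hxW y hyW hyx hxy
  let ok : V → Prop := fun w => w ∈ W ∧ w ≠ x ∧ ¬ G.Adj x w
  -- `H` is the component of `y` in `W` minus the closed neighbourhood of `x`. Its outer boundary
  -- `S` in `W` consists of neighbours of `x`, and is a clique because any two of its vertices are
  -- joined by a walk through `H`.
  let H : V → Prop := fun h => ∃ p : G.Walk y h, ∀ w ∈ p.support, ok w
  have hHok : ∀ h, H h → ok h := fun h ⟨p, hp⟩ => hp h p.end_mem_support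
  have hHy : H y := ⟨.nil, by simpa [ok] using ⟨hyW, hyx, hxy⟩⟩
  have hHstep : ∀ h w, H h → G.Adj h w → ok w → H w := by
    rintro h w ⟨p, hp⟩ hhw hw
    refine ⟨p.concat hhw, fun c hc => ?_⟩
    rw [Walk.support_concat] at hc
    simp only [List.mem_append, List.mem_singleton] at hc
    rcases hc with hc | rfl
    · exact hp c hc
    · exact hw
  let S : V → Prop := fun s => s ∈ W ∧ ¬ H s ∧ ∃ h, H h ∧ G.Adj h s
  have hSx : ∀ s, S s → G.Adj x s := by
    rintro s ⟨hsW, hsH, h, hh, hhs⟩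
    by_contra hxs
    refine hsH (hHstep h s hh hhs ⟨hsW, ?_, hxs⟩)
    rintro rfl
    exact (hHok h hh).2.2 hhs.symm
  have hSclique : ∀ s t, S s → S t → s ≠ t → G.Adj s t := by
    intro s t hs ht hst
    obtain ⟨-, -, h₁, ⟨p₁, hp₁⟩, ha₁⟩ := id hs
    obtain ⟨-, -, h₂, ⟨p₂, hp₂⟩, ha₂⟩ := id ht
    refine hG.adj_of_walk (hSx s hs) (hSx t ht) hst
      (.cons ha₁.symm ((p₁.reverse.append p₂).concat ha₂)) fun w hw => ?_
    simp only [Walk.support_cons, Walk.support_concat, List.mem_cons,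
      List.mem_append, List.not_mem_nil, or_false, Walk.mem_support_append_iff,
      Walk.support_reverse, List.mem_reverse] at hw
    rcases hw with rfl | (hw | hw) | rfl
    · exact .inl rfl
    · exact .inr (.inr (hp₁ w hw).2)
    · exact .inr (.inr (hp₂ w hw).2)
    · exact .inr (.inl rfl)
  let W' : Finset V := W.filter fun w => H w ∨ S w
  have hW'W : W' ⊂ W := by
    refine Finset.ssubset_iff_subset_ne.2 ⟨Finset.filter_subset _ _, fun h => ?_⟩
    have hx' : x ∈ W' := h ▸ hxW
    rcases (Finset.mem_filter.1 hx').2 with hx | hx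
    · exact (hHok x hx).2.1 rfl
    · exact G.loopless.irrefl _ (hSx x hx)
  have hHW' : ∀ h, H h → h ∈ W' := fun h hh => Finset.mem_filter.2 ⟨(hHok h hh).1, .inl hh⟩
  -- All neighbours in `W` of a vertex of `H` lie in `W'`, so simpliciality in `W'` is enough.
  suffices h : ∃ v, H v ∧ G.IsClique {w | w ∈ W' ∧ G.Adj v w} by
    obtain ⟨v, hv, hcl⟩ := h
    refine ⟨v, (hHok v hv).1, (hHok v hv).2.1, (hHok v hv).2.2, hcl.subset ?_⟩
    rintro w ⟨hw, hvw⟩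
    refine ⟨Finset.mem_filter.2 ⟨hw, ?_⟩, hvw⟩
    by_cases h : H w
    · exact .inl h
    · exact .inr ⟨hw, h, v, hv, hvw⟩
  by_cases hcl : ∃ a ∈ W', ∃ b ∈ W', b ≠ a ∧ ¬ G.Adj a b
  -- With base vertex in the clique `S`, the simplicial vertex found is not adjacent to it, so it
  -- lies in `H`. If another base vertex leads to a vertex of `S`, the induction hypothesis is
  -- applied once more with that vertex as base.
  · have hcaseS : (∃ a ∈ W', S a ∧ ∃ b ∈ W', b ≠ a ∧ ¬ G.Adj a b) →
        ∃ v, H v ∧ G.IsClique {w | w ∈ W' ∧ G.Adj v w} := by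
      rintro ⟨a, ha, haS, b, hb, hba, hab⟩
      obtain ⟨v, hv, hva, hav, hcl⟩ := ih W' hW'W a ha b hb hba hab
      refine ⟨v, (Finset.mem_filter.1 hv).2.resolve_right fun hvS => ?_, hcl⟩
      exact hav (hSclique a v haS hvS hva.symm)
    obtain ⟨a, ha, b, hb, hba, hab⟩ := hcl
    obtain ⟨v, hv, hva, hav, hcl⟩ := ih W' hW'W a ha b hb hba hab
    rcases (Finset.mem_filter.1 hv).2 with hvH | hvS
    · exact ⟨v, hvH, hcl⟩
    · exact hcaseS ⟨v, hv, hvS, a, ha, hva.symm, fun h => hav h.symm⟩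
  · push Not at hcl
    exact ⟨y, hHy, fun a ha b hb hab => hcl a ha.1 b hb.1 hab.symm⟩

/-- Every nonempty induced subgraph of a chordal graph has a simplicial vertex. -/
lemma IsChordalGraph.exists_simplicial (hG : G.IsChordalGraph) (W : Finset V) (hW : W.Nonempty) :
    ∃ v ∈ W, G.IsClique {w | w ∈ W ∧ G.Adj v w} := by
  by_cases h : ∃ x ∈ W, ∃ y ∈ W, y ≠ x ∧ ¬ G.Adj x y
  · obtain ⟨x, hx, y, hy, hyx, hxy⟩ := h
    obtain ⟨v, hv, -, -, hcl⟩ := hG.exists_simplicial_not_adj W x hx y hy hyx hxy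
    exact ⟨v, hv, hcl⟩
  · push Not at h
    obtain ⟨v, hv⟩ := hW
    exact ⟨v, hv, fun a ha b hb hab => h a ha.1 b hb.1 hab.symm⟩

end SimpleGraph

/-! ### Positive definiteness on coordinate subspaces -/

section

open Filter Topology

variable {V : Type*}

namespace Matrix

/-- Extension by zero of a vector indexed by a finite set. -/
def extendZero [DecidableEq V] (C : Finset V) (z : C → ℝ) : V → ℝ :=
  fun i => if h : i ∈ C then z ⟨i, h⟩ else 0

lemma extendZero_of_notMem [DecidableEq V] {C : Finset V} (z : C → ℝ) {i : V} (h : i ∉ C) :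
    extendZero C z i = 0 := dif_neg h

@[simp] lemma extendZero_coe [DecidableEq V] {C : Finset V} (z : C → ℝ) (i : C) :
    extendZero C z i = z i :=
  dif_pos i.2

variable [Fintype V]

/-- The quadratic form of `M` is positive definite on the vectors supported on `C`. -/
def PosDefOn (M : Matrix V V ℝ) (C : Finset V) : Prop :=
  ∀ z : V → ℝ, (∀ i ∉ C, z i = 0) → z ≠ 0 → 0 < z ⬝ᵥ M *ᵥ z

lemma mulVec_congr_of_support {M N : Matrix V V ℝ} {C : Finset V} {z : V → ℝ}
    (hz : ∀ i ∉ C, z i = 0) {j : V} (h : ∀ i ∈ C, M j i = N j i) : (M *ᵥ z) j = (N *ᵥ z) j := by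
  refine Finset.sum_congr rfl fun i _ => ?_
  by_cases hi : i ∈ C
  · exact congrArg (· * z i) (h i hi)
  · simp [hz i hi]

lemma dotProduct_congr_of_support {C : Finset V} {z u v : V → ℝ}
    (hz : ∀ i ∉ C, z i = 0) (h : ∀ i ∈ C, u i = v i) : z ⬝ᵥ u = z ⬝ᵥ v := by
  refine Finset.sum_congr rfl fun i _ => ?_
  by_cases hi : i ∈ C
  · rw [h i hi]
  · simp [hz i hi]

lemma dotProduct_mulVec_congr {M N : Matrix V V ℝ} {C : Finset V}
    (h : ∀ i ∈ C, ∀ j ∈ C, M i j = N i j) {z : V → ℝ} (hz : ∀ i ∉ C, z i = 0) :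
    z ⬝ᵥ M *ᵥ z = z ⬝ᵥ N *ᵥ z :=
  dotProduct_congr_of_support hz fun i hi => mulVec_congr_of_support hz (h i hi)

lemma PosDefOn.congr {M N : Matrix V V ℝ} {C : Finset V} (hM : M.PosDefOn C)
    (h : ∀ i ∈ C, ∀ j ∈ C, M i j = N i j) : N.PosDefOn C := fun z hz hz0 => by
  rw [← dotProduct_mulVec_congr h hz]
  exact hM z hz hz0

lemma PosDefOn.mono {M : Matrix V V ℝ} {C D : Finset V} (hM : M.PosDefOn D) (h : C ⊆ D) :
    M.PosDefOn C := fun z hz => hM z fun i hi => hz i fun hC => hi (h hC)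

lemma PosDefOn.nonneg {M : Matrix V V ℝ} {C : Finset V} (hM : M.PosDefOn C) {z : V → ℝ}
    (hz : ∀ i ∉ C, z i = 0) : 0 ≤ z ⬝ᵥ M *ᵥ z := by
  rcases eq_or_ne z 0 with rfl | h
  · simp
  · exact (hM z hz h).le

lemma IsSymm.dotProduct_mulVec_comm {M : Matrix V V ℝ} (hM : M.IsSymm) (y w : V → ℝ) :
    y ⬝ᵥ M *ᵥ w = w ⬝ᵥ M *ᵥ y := by
  rw [dotProduct_mulVec, ← mulVec_transpose, hM.eq, dotProduct_comm]

lemma IsSymm.dotProduct_mulVec_add_smul {M : Matrix V V ℝ} (hM : M.IsSymm) (y w : V → ℝ) (c : ℝ) :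
    (y + c • w) ⬝ᵥ M *ᵥ (y + c • w) =
      y ⬝ᵥ M *ᵥ y + 2 * c * (y ⬝ᵥ M *ᵥ w) + c ^ 2 * (w ⬝ᵥ M *ᵥ w) := by
  simp only [mulVec_add, mulVec_smul, dotProduct_add, add_dotProduct, smul_dotProduct,
    dotProduct_smul, smul_eq_mul]
  rw [hM.dotProduct_mulVec_comm w y]
  ring

lemma mulVec_eq_submatrix_mulVec (M : Matrix V V ℝ) {C : Finset V} {z : V → ℝ}
    (hz : ∀ i ∉ C, z i = 0) (j : C) :
    (M *ᵥ z) j = (M.submatrix (fun i : C => (i : V)) (fun i : C => (i : V)) *ᵥ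
      fun i : C => z i) j := by
  simp only [mulVec, dotProduct, submatrix_apply]
  rw [Finset.sum_coe_sort C (fun i => M j i * z i)]
  refine (Finset.sum_subset (Finset.subset_univ C) fun i _ hi => ?_).symm
  simp [hz i hi]

section extend

variable [DecidableEq V]

/-- Kernel vectors are extended by zero, so that blocks of different index sets can be compared
within the single space `V → ℝ`. -/
lemma det_submatrix_eq_zero_iff (M : Matrix V V ℝ) (C : Finset V) :
    (M.submatrix (fun i : C => (i : V)) (fun i : C => (i : V))).det = 0 ↔
      ∃ z : V → ℝ, (∀ i ∉ C, z i = 0) ∧ z ≠ 0 ∧ ∀ j ∈ C, (M *ᵥ z) j = 0 := by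
  rw [← exists_mulVec_eq_zero_iff]
  constructor
  · rintro ⟨z, hz0, hz⟩
    have hsupp : ∀ i ∉ C, extendZero C z i = 0 := fun i hi => extendZero_of_notMem z hi
    refine ⟨extendZero C z, hsupp, fun h => hz0 ?_, fun j hj => ?_⟩
    · ext i
      simpa using congrFun h i
    · rw [mulVec_eq_submatrix_mulVec M hsupp ⟨j, hj⟩]
      simpa using congrFun hz ⟨j, hj⟩
  · rintro ⟨z, hsupp, hz0, hz⟩
    refine ⟨fun i => z i, fun h => hz0 ?_, ?_⟩
    · ext i
      by_cases hi : i ∈ C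
      · exact congrFun h ⟨i, hi⟩
      · exact hsupp i hi
    · ext j
      rw [← mulVec_eq_submatrix_mulVec M hsupp j]
      exact hz j j.2

lemma PosDefOn.det_ne_zero {M : Matrix V V ℝ} {C : Finset V} (hM : M.PosDefOn C) :
    (M.submatrix (fun i : C => (i : V)) (fun i : C => (i : V))).det ≠ 0 := by
  intro h
  obtain ⟨z, hz, hz0, hk⟩ := (det_submatrix_eq_zero_iff M C).1 h
  have := hM z hz hz0
  rw [dotProduct_congr_of_support (v := 0) hz hk] at this
  simp at this

lemma PosDefOn.exists_mulVec_eq {M : Matrix V V ℝ} {C : Finset V} (hM : M.PosDefOn C)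
    (b : V → ℝ) : ∃ w : V → ℝ, (∀ i ∉ C, w i = 0) ∧ ∀ j ∈ C, (M *ᵥ w) j = b j := by
  set A := M.submatrix (fun i : C => (i : V)) (fun i : C => (i : V)) with hA
  have hu : IsUnit A.det := isUnit_iff_ne_zero.2 hM.det_ne_zero
  let z : C → ℝ := A⁻¹ *ᵥ fun i : C => b i
  have hsupp : ∀ i ∉ C, extendZero C z i = 0 := fun i hi => extendZero_of_notMem z hi
  refine ⟨extendZero C z, hsupp, fun j hj => ?_⟩
  rw [mulVec_eq_submatrix_mulVec M hsupp ⟨j, hj⟩]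
  have : A *ᵥ z = fun i : C => b i := by simp [z, mulVec_mulVec, mul_nonsing_inv A hu]
  simpa using congrFun this ⟨j, hj⟩

/-- A positive semidefinite principal block with nonzero determinant is positive definite. -/
lemma posDefOn_of_nonneg_of_det_ne_zero {M : Matrix V V ℝ} (hM : M.IsSymm) {C : Finset V}
    (h : ∀ z : V → ℝ, (∀ i ∉ C, z i = 0) → 0 ≤ z ⬝ᵥ M *ᵥ z)
    (hdet : (M.submatrix (fun i : C => (i : V)) (fun i : C => (i : V))).det ≠ 0) :
    M.PosDefOn C := by
  intro z hz hz0
  refine (h z hz).lt_of_ne' fun h0 => hdet ((det_submatrix_eq_zero_iff M C).2 ⟨z, hz, hz0, ?_⟩)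
  intro j hj
  by_contra hne
  set e : V → ℝ := Pi.single j 1
  set d := e ⬝ᵥ M *ᵥ e
  set b := (M *ᵥ z) j with hb
  have hze : e ⬝ᵥ M *ᵥ z = b := by simp [e, hb]
  have key : ∀ c : ℝ, 0 ≤ 2 * c * b + c ^ 2 * d := fun c => by
    have := h (z + c • e) fun i hi => by
      have hij : i ≠ j := fun h => hi (h ▸ hj)
      simp [e, hz i hi, hij]
    rwa [hM.dotProduct_mulVec_add_smul, h0, zero_add, hM.dotProduct_mulVec_comm, hze] at this
  have hd : 0 ≤ d := h e fun i hi => by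
    have hij : i ≠ j := fun h => hi (h ▸ hj)
    simp [e, hij]
  -- The exact minimiser would be `-b / d`; adding one to the denominator also covers `d = 0` and
  -- still makes the value negative.
  have h1 := key (-b / (d + 1))
  have h2 : 2 * (-b / (d + 1)) * b + (-b / (d + 1)) ^ 2 * d = -(b ^ 2 * (d + 2)) / (d + 1) ^ 2 := by
    field_simp
    ring
  rw [h2] at h1
  have h3 : 0 < b ^ 2 * (d + 2) := by positivity
  have h4 : -(b ^ 2 * (d + 2)) / (d + 1) ^ 2 < 0 :=
    div_neg_of_neg_of_pos (by linarith) (by positivity)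
  linarith

/-- A singular principal block is positive semidefinite if it becomes positive definite after
one index is removed. -/
lemma nonneg_of_posDefOn_erase {M : Matrix V V ℝ} (hM : M.IsSymm) {C : Finset V} {i : V}
    (h : M.PosDefOn (C.erase i))
    (hdet : (M.submatrix (fun i : C => (i : V)) (fun i : C => (i : V))).det = 0)
    {z : V → ℝ} (hz : ∀ j ∉ C, z j = 0) : 0 ≤ z ⬝ᵥ M *ᵥ z := by
  obtain ⟨u, hu, hu0, hk⟩ := (det_submatrix_eq_zero_iff M C).1 hdet
  have hdot : ∀ y : V → ℝ, (∀ j ∉ C, y j = 0) → y ⬝ᵥ M *ᵥ u = 0 := fun y hy => by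
    rw [dotProduct_congr_of_support (v := 0) hy hk, dotProduct_zero]
  have hui : u i ≠ 0 := fun h0 => by
    refine (h u (fun j hj => ?_) hu0).ne' (hdot u hu)
    rcases eq_or_ne j i with rfl | hji
    · exact h0
    · exact hu j fun hjC => hj (Finset.mem_erase.2 ⟨hji, hjC⟩)
  -- Adding a multiple of the kernel vector does not change the form; this multiple cancels the
  -- coordinate at `i`.
  have hq := hM.dotProduct_mulVec_add_smul z u (-(z i / u i))
  rw [hdot z hz, hdot u hu, mul_zero, mul_zero, add_zero, add_zero] at hq
  rw [← hq]
  refine h.nonneg fun j hj => ?_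
  rcases eq_or_ne j i with rfl | hji
  · simp [hui]
  · have hjC : j ∉ C := fun hjC => hj (Finset.mem_erase.2 ⟨hji, hjC⟩)
    simp [hz j hjC, hu j hjC]

end extend

/-- By homogeneity, positivity need only be tested on the unit sphere of the coordinate subspace,
which is compact. -/
lemma PosDefOn.eventually {M : Matrix V V ℝ} {C : Finset V} (hM : M.PosDefOn C) :
    ∀ᶠ N in 𝓝 M, PosDefOn N C := by
  have hK : IsCompact (Metric.sphere (0 : V → ℝ) 1 ∩ {z | ∀ i ∉ C, z i = 0}) := by
    refine (isCompact_sphere _ _).inter_right ?_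
    simp only [Set.ofPred_forall]
    exact isClosed_iInter fun i => isClosed_iInter fun _ =>
      isClosed_eq (continuous_apply i) continuous_const
  have hev := hK.eventually_forall_of_forall_eventually (x₀ := M)
    (P := fun N z => 0 < z ⬝ᵥ N *ᵥ z) fun z hz => by
      have hcont : Continuous fun q : Matrix V V ℝ × (V → ℝ) => q.2 ⬝ᵥ q.1 *ᵥ q.2 := by fun_prop
      refine (hcont.tendsto (M, z)).eventually_const_lt (hM z hz.2 fun h => ?_)
      have := hz.1
      simp [h] at this
  filter_upwards [hev] with N hN z hz hz0
  have hn : ‖z‖ ≠ 0 := norm_ne_zero_iff.2 hz0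
  have := hN (‖z‖⁻¹ • z) ⟨by simp [norm_smul, hn], fun i hi => by simp [hz i hi]⟩
  rw [mulVec_smul, dotProduct_smul, smul_dotProduct, smul_eq_mul, smul_eq_mul] at this
  exact pos_of_mul_pos_right (pos_of_mul_pos_right this (by positivity)) (by positivity)

end Matrix

/-! ### Positive definite completion -/

open Matrix

variable [Fintype V]

/-- A partial symmetric matrix with a chordal pattern, all of whose specified principal blocks are
positive definite, has a positive definite completion on every set of indices. -/
lemma SimpleGraph.IsChordalGraph.exists_completion {G : SimpleGraph V} (hG : G.IsChordalGraph)
    {T : Matrix V V ℝ} (hT : T.IsSymm)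
    (hpd : ∀ C : Finset V, G.IsClique (C : Set V) → T.PosDefOn C) (W : Finset V) :
    ∃ S : Matrix V V ℝ, S.IsSymm ∧ (∀ i ∉ W, ∀ j, S i j = 0) ∧
      (∀ i ∈ W, ∀ j ∈ W, (i = j ∨ G.Adj i j) → S i j = T i j) ∧ S.PosDefOn W := by
  classical
  induction W using Finset.strongInduction with
  | H W ih =>
  rcases W.eq_empty_or_nonempty with rfl | hW
  · exact ⟨0, by simp [Matrix.IsSymm], by simp, by simp, fun z hz hz0 =>
      absurd (funext fun i => hz i (by simp)) hz0⟩
  obtain ⟨v, hvW, hcl⟩ := hG.exists_simplicial W hW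
  obtain ⟨S, hS, hS0, hST, hSpd⟩ := ih (W.erase v) (Finset.erase_ssubset hvW)
  let N : Finset V := W.filter fun w => G.Adj v w
  have hvN : v ∉ N := by simp [N]
  have hNcl : G.IsClique (N : Set V) := hcl.subset fun w hw => by simpa [N] using hw
  have hNW : ∀ j ∈ N, j ∈ W.erase v := fun j hj =>
    Finset.mem_erase.2 ⟨fun h => hvN (h ▸ hj), (Finset.mem_filter.1 hj).1⟩
  have hvNcl : G.IsClique ((insert v N : Finset V) : Set V) := by
    rw [Finset.coe_insert]
    exact hNcl.insert fun b hb _ => (Finset.mem_filter.1 hb).2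
  -- The new column will be `S *ᵥ w`: on `N` it has the prescribed values, and elsewhere it supplies
  -- the missing entries.
  obtain ⟨w, hw, hwT⟩ := (hpd N hNcl).exists_mulVec_eq (T v)
  have hSN : ∀ i ∈ N, ∀ j ∈ N, S i j = T i j := fun i hi j hj =>
    hST i (hNW i hi) j (hNW j hj) ((eq_or_ne i j).imp_right (hNcl hi hj))
  have hSw : ∀ j ∈ N, (S *ᵥ w) j = T v j := fun j hj => by
    rw [mulVec_congr_of_support hw (hSN j hj), hwT j hj]
  have hSw0 : ∀ j ∉ W.erase v, (S *ᵥ w) j = 0 := fun j hj => by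
    simp [mulVec, dotProduct, hS0 j hj]
  set e : V → ℝ := Pi.single v 1 with he
  set q := w ⬝ᵥ S *ᵥ w with hq
  -- `T v v - q` is the Schur complement of `v` in the clique `insert v N`, that is, the value of
  -- the form at `e - w`.
  have hqlt : q < T v v := by
    have h1 := hpd _ hvNcl (e + (-1 : ℝ) • w) (fun i hi => by
        rw [Finset.mem_insert, not_or] at hi
        simp [e, hi.1, hw i hi.2]) (fun h => by
        have := congrFun h v
        simp [e, hw v hvN] at this)
    have hTv : e ⬝ᵥ T *ᵥ e = T v v := by simp [e]
    have hwq : w ⬝ᵥ T *ᵥ w = q := (dotProduct_mulVec_congr hSN hw).symm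
    have hew : e ⬝ᵥ T *ᵥ w = q := by
      rw [hT.dotProduct_mulVec_comm, ← hwq]
      refine dotProduct_congr_of_support hw fun j hj => ?_
      rw [hwT j hj]
      simp [e, hT.apply]
    rw [hT.dotProduct_mulVec_add_smul, hTv, hwq, hew] at h1
    linarith
  let S' : Matrix V V ℝ := S + vecMulVec e (S *ᵥ w) + vecMulVec (S *ᵥ w) e +
    (T v v) • vecMulVec e e
  -- Completing the square: positivity of `S'` splits into that of `S` off `v` and that of the Schur
  -- complement.
  have hS'q : ∀ z : V → ℝ, z ⬝ᵥ S' *ᵥ z =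
      (z + z v • w) ⬝ᵥ S *ᵥ (z + z v • w) + z v ^ 2 * (T v v - q) := fun z => by
    rw [hS.dotProduct_mulVec_add_smul]
    have hez : e ⬝ᵥ z = z v := by simp [e]
    have hze : z ⬝ᵥ e = z v := by simp [e]
    simp only [S', add_mulVec, vecMulVec_mulVec, smul_mulVec, dotProduct_add, dotProduct_smul,
      hez, hze, MulOpposite.smul_eq_mul_unop, MulOpposite.unop_op, smul_eq_mul]
    rw [dotProduct_comm (S *ᵥ w) z, ← hq]
    ring
  have hSz : ∀ z : V → ℝ, (∀ i ∉ W, z i = 0) → z ⬝ᵥ S *ᵥ z =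
      (z - z v • e) ⬝ᵥ S *ᵥ (z - z v • e) := fun z hz => by
    have hSe : S *ᵥ e = 0 := by
      ext j
      simp [e, ← hS.apply, hS0 v (Finset.notMem_erase v W)]
    have := hS.dotProduct_mulVec_add_smul z e (-z v)
    rw [hSe] at this
    simp only [dotProduct_zero, mul_zero, add_zero] at this
    rw [← this, neg_smul, sub_eq_add_neg]
  refine ⟨S', ?_, fun i hi j => ?_, fun i hi j hj hij => ?_, fun z hz hz0 => ?_⟩
  · refine Matrix.IsSymm.ext fun i j => ?_
    simp only [S', Matrix.add_apply, vecMulVec_apply, Matrix.smul_apply, smul_eq_mul, hS.apply]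
    ring
  · have hiv : i ≠ v := fun h => hi (h ▸ hvW)
    have hi' : i ∉ W.erase v := fun h => hi (Finset.mem_of_mem_erase h)
    simp [S', vecMulVec_apply, hS0 i hi', hSw0 i hi', e, hiv]
  · rcases eq_or_ne i v with rfl | hiv
    · have h0 : S i j = 0 := hS0 i (Finset.notMem_erase i W) j
      have h0' := hSw0 i (Finset.notMem_erase i W)
      rcases eq_or_ne j i with rfl | hji
      · simp [S', vecMulVec_apply, h0, h0', e]
      · have hjN : j ∈ N := Finset.mem_filter.2 ⟨hj, hij.resolve_left hji.symm⟩
        simp [S', vecMulVec_apply, h0, h0', e, hji, hSw j hjN]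
    · have hiW : i ∈ W.erase v := Finset.mem_erase.2 ⟨hiv, hi⟩
      rcases eq_or_ne j v with rfl | hjv
      · have hiN : i ∈ N := Finset.mem_filter.2 ⟨hi, (hij.resolve_left hiv).symm⟩
        have h0 : S i j = 0 := by rw [← hS.apply]; exact hS0 j (Finset.notMem_erase j W) i
        simp [S', vecMulVec_apply, h0, e, hiv, hSw i hiN, hT.apply]
      · have hjW : j ∈ W.erase v := Finset.mem_erase.2 ⟨hjv, hj⟩
        simp [S', vecMulVec_apply, e, hiv, hjv, hST i hiW j hjW hij]
  · rw [hS'q z]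
    have hsupp : ∀ i ∉ W, (z + z v • w) i = 0 := fun i hi => by
      have : i ∉ N := fun h => hi (Finset.mem_filter.1 h).1
      simp [hz i hi, hw i this]
    rw [hSz _ hsupp]
    have hsupp' : ∀ i ∉ W.erase v, ((z + z v • w) - (z + z v • w) v • e) i = 0 := fun i hi => by
      rcases eq_or_ne i v with rfl | hiv
      · simp [e]
      · have hiW : i ∉ W := fun h => hi (Finset.mem_erase.2 ⟨hiv, h⟩)
        have := hsupp i hiW
        simp only [Pi.sub_apply, this]
        simp [e, hiv]
    rcases eq_or_ne (z v) 0 with hzv | hzv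
    · have hz' : (z + z v • w) - (z + z v • w) v • e = z := by
        simp [hzv]
      rw [hz', hzv]
      have := hSpd z (fun i hi => by rw [← hz']; exact hsupp' i hi) hz0
      simpa using this
    · have h1 := hSpd.nonneg hsupp'
      have h2 : 0 < z v ^ 2 * (T v v - q) := mul_pos (by positivity) (by linarith)
      linarith

end

/-! ### Polynomials linear in one variable -/

open MvPolynomial in
/-- Pseudo-division by a polynomial that is linear in the variable `e`. -/
lemma MvPolynomial.exists_pow_mul_eq_mul_add {σ R : Type*} [CommRing R] (e : σ)
    {D s : MvPolynomial σ R} (hD : D ∈ supported R ({e}ᶜ : Set σ))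
    (hs : s ∈ supported R ({e}ᶜ : Set σ)) (f : MvPolynomial σ R) :
    ∃ (N : ℕ) (q g : MvPolynomial σ R), g ∈ supported R ({e}ᶜ : Set σ) ∧
      D ^ N * f = (D * X e + s) * q + g := by
  induction f using MvPolynomial.induction_on with
  | C a => exact ⟨0, 0, C a, Subalgebra.algebraMap_mem _ a, by simp⟩
  | add f₁ f₂ ih₁ ih₂ =>
    obtain ⟨N₁, q₁, g₁, hg₁, h₁⟩ := ih₁
    obtain ⟨N₂, q₂, g₂, hg₂, h₂⟩ := ih₂
    refine ⟨N₁ + N₂, D ^ N₂ * q₁ + D ^ N₁ * q₂, D ^ N₂ * g₁ + D ^ N₁ * g₂,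
      add_mem (mul_mem (pow_mem hD _) hg₁) (mul_mem (pow_mem hD _) hg₂), ?_⟩
    linear_combination D ^ N₂ * h₁ + D ^ N₁ * h₂
  | mul_X f i ih =>
    obtain ⟨N, q, g, hg, h⟩ := ih
    rcases eq_or_ne i e with rfl | hi
    -- The new remainder comes from `g * (D * X i) = g * (D * X i + s) - s * g`.
    · refine ⟨N + 1, D * q * X i + g, -(s * g), neg_mem (mul_mem hs hg), ?_⟩
      linear_combination D * X i * h
    · refine ⟨N, q * X i, g * X i, mul_mem hg (Algebra.subset_adjoin ⟨i, hi, rfl⟩), ?_⟩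
      linear_combination X i * h

lemma MvPolynomial.aeval_congr_of_supported {σ R A : Type*} [CommRing R] [CommRing A] [Algebra R A]
    {S : Set σ} {p : MvPolynomial σ R} (hp : p ∈ supported R S) {x y : σ → A}
    (h : ∀ e ∈ S, x e = y e) : aeval x p = aeval y p := by
  refine Algebra.adjoin_induction (p := fun p _ => aeval x p = aeval y p) ?_ ?_ ?_ ?_ hp
  · rintro _ ⟨e, he, rfl⟩
    simpa using h e he
  · intro r
    simp
  · intro p q _ _ hp hq
    simp [hp, hq]
  · intro p q _ _ hp hq
    simp [hp, hq]

/-! ### Generic clique minors and their irreducibility -/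

namespace SimpleGraph

open MvPolynomial Matrix

variable {V : Type*} (G : SimpleGraph V)

open Classical in
/-- The symmetric matrix with the given entries in the specified positions and zeros elsewhere. -/
noncomputable def partialMatrix {R : Type*} [CommRing R] (t : G.LoopEdge → R) : Matrix V V R :=
  Matrix.of fun i j => if h : s(i, j).IsDiag ∨ s(i, j) ∈ G.edgeSet then t ⟨s(i, j), h⟩ else 0

/-- The restriction of a symmetric matrix to the specified positions. -/
def restrictMatrix {R : Type*} (S : Matrix V V R) (hS : S.IsSymm) : G.LoopEdge → R :=
  fun e => Sym2.lift ⟨fun i j => S i j, fun i j => (hS.apply i j).symm⟩ e.1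

/-- The position of a diagonal entry. -/
def loopAt (i : V) : G.LoopEdge := ⟨s(i, i), .inl rfl⟩

section partialMatrix

variable {R : Type*} [CommRing R]

lemma partialMatrix_apply (t : G.LoopEdge → R) {i j : V}
    (h : s(i, j).IsDiag ∨ s(i, j) ∈ G.edgeSet) : G.partialMatrix t i j = t ⟨s(i, j), h⟩ := by
  simp only [partialMatrix, Matrix.of_apply]
  exact dif_pos h

lemma partialMatrix_isSymm (t : G.LoopEdge → R) : (G.partialMatrix t).IsSymm := by
  refine Matrix.IsSymm.ext fun i j => ?_
  classical
  have h : ∀ e e' : Sym2 V, e = e' →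
      (if h : e.IsDiag ∨ e ∈ G.edgeSet then t ⟨e, h⟩ else 0) =
        if h : e'.IsDiag ∨ e' ∈ G.edgeSet then t ⟨e', h⟩ else 0 := by
    rintro e _ rfl
    rfl
  simp only [partialMatrix, Matrix.of_apply]
  convert h s(j, i) s(i, j) Sym2.eq_swap

lemma map_partialMatrix {A F : Type*} [CommRing A] [FunLike F R A] [RingHomClass F R A] (f : F)
    (t : G.LoopEdge → R) : (G.partialMatrix t).map f = G.partialMatrix fun e => f (t e) := by
  ext i j
  simp only [partialMatrix, Matrix.map_apply, Matrix.of_apply]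
  split_ifs <;> simp

lemma partialMatrix_restrictMatrix (S : Matrix V V R) (hS : S.IsSymm) {i j : V}
    (h : i = j ∨ G.Adj i j) : G.partialMatrix (G.restrictMatrix S hS) i j = S i j := by
  have h' : s(i, j).IsDiag ∨ s(i, j) ∈ G.edgeSet := by simpa using h
  rw [partialMatrix_apply _ _ h']
  rfl

lemma genericPartialMatrix_eq : G.genericPartialMatrix R = G.partialMatrix X := rfl

end partialMatrix

open Classical in
/-- The inclusion-maximal cliques. -/
noncomputable def maximalCliques [Fintype V] : Finset (Finset V) :=
  {C | Maximal G.IsClique (C : Set V)}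

variable {G} in
lemma mem_maximalCliques [Fintype V] {C : Finset V} :
    C ∈ G.maximalCliques ↔ Maximal G.IsClique (C : Set V) := by
  simp [maximalCliques]

variable [DecidableEq V] (R : Type*) [CommRing R]

/-- The principal minor of the generic partial matrix with index set `C`. -/
noncomputable def genericMinor (C : Finset V) : MvPolynomial G.LoopEdge R :=
  ((G.genericPartialMatrix R).submatrix (fun i : C => (i : V)) (fun j : C => (j : V))).det

lemma maximalCliqueMinorProduct_eq [Fintype V] :
    G.maximalCliqueMinorProduct R = ∏ C ∈ G.maximalCliques, G.genericMinor R C := by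
  classical
  unfold maximalCliqueMinorProduct
  symm
  -- The product being matched is indexed by sets, hence the coercion and the passage back through
  -- `Set.toFinset`.
  refine Finset.prod_bij (fun C _ => (C : Set V)) (fun C hC => ?_)
    (fun C _ D _ h => Finset.coe_injective h) (fun C hC => ?_) (fun C hC => ?_)
  · rw [Finset.mem_filter]
    exact ⟨by simp, mem_maximalCliques.1 hC⟩
  · rw [Finset.mem_filter] at hC
    obtain ⟨D, rfl⟩ : ∃ D : Finset V, (D : Set V) = C := ⟨_, C.coe_toFinset⟩
    exact ⟨D, mem_maximalCliques.2 hC.2, rfl⟩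
  · unfold genericMinor
    congr!

lemma aeval_genericMinor {A : Type*} [CommRing A] [Algebra R A] (x : G.LoopEdge → A)
    (C : Finset V) : aeval x (G.genericMinor R C) =
      ((G.partialMatrix x).submatrix (fun i : C => (i : V)) (fun j : C => (j : V))).det := by
  rw [genericMinor, AlgHom.map_det, genericPartialMatrix_eq]
  congr 1
  rw [AlgHom.mapMatrix_apply, ← Matrix.submatrix_map, map_partialMatrix]
  simp

lemma genericPartialMatrix_mem_supported {i a b : V} (h : ¬ (a = i ∧ b = i)) :
    G.genericPartialMatrix R a b ∈ supported R ({G.loopAt i}ᶜ : Set G.LoopEdge) := by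
  simp only [genericPartialMatrix, Matrix.of_apply]
  split_ifs with hab
  · refine Algebra.subset_adjoin ⟨_, ?_, rfl⟩
    simpa [loopAt, Subtype.ext_iff] using h
  · exact zero_mem _

lemma _root_.Matrix.det_mem_subalgebra {R A n : Type*} [CommRing R] [CommRing A] [Algebra R A]
    [Fintype n] [DecidableEq n] (S : Subalgebra R A) {M : Matrix n n A} (h : ∀ i j, M i j ∈ S) :
    M.det ∈ S := by
  rw [Matrix.det_apply]
  refine sum_mem fun σ _ => ?_
  rw [Units.smul_def]
  exact zsmul_mem (prod_mem fun i _ => h _ _) _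

lemma genericMinor_mem_supported {C : Finset V} {i : V} (hi : i ∉ C) :
    G.genericMinor R C ∈ supported R ({G.loopAt i}ᶜ : Set G.LoopEdge) :=
  Matrix.det_mem_subalgebra _ fun a _ =>
    G.genericPartialMatrix_mem_supported R fun h => hi (h.1 ▸ a.2)

/-- Allows reindexing by `Fin`, where the cofactor expansion along row zero is available. -/
lemma _root_.Matrix.det_submatrix_of_image {R ι V : Type*} [CommRing R] [Fintype ι] [DecidableEq ι]
    [DecidableEq V] (M : Matrix V V R) (C : Finset V) (c : ι → V) (hc : Function.Injective c)
    (h : ∀ v, v ∈ C ↔ ∃ k, c k = v) :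
    (M.submatrix c c).det = (M.submatrix (fun i : C => (i : V)) (fun i : C => (i : V))).det := by
  let e : ι ≃ C := Equiv.ofBijective (fun k => ⟨c k, (h _).2 ⟨k, rfl⟩⟩)
    ⟨fun a b hab => hc (congrArg Subtype.val hab), fun v => by
      obtain ⟨k, hk⟩ := (h v).1 v.2
      exact ⟨k, Subtype.ext hk⟩⟩
  rw [← Matrix.det_submatrix_equiv_self e]
  rfl

/-- Expansion of a generic principal minor with respect to a diagonal variable. -/
lemma exists_genericMinor_eq {C : Finset V} {i : V} (hi : i ∈ C) :
    ∃ s ∈ supported R ({G.loopAt i}ᶜ : Set G.LoopEdge),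
      G.genericMinor R C = G.genericMinor R (C.erase i) * X (G.loopAt i) + s := by
  set T := G.genericPartialMatrix R
  let c' : Fin (C.erase i).card → V := fun k => (C.erase i).equivFin.symm k
  have hc' : Function.Injective c' :=
    Subtype.val_injective.comp (C.erase i).equivFin.symm.injective
  have hmem' : ∀ v, v ∈ C.erase i ↔ ∃ k, c' k = v := fun v =>
    ⟨fun hv => ⟨(C.erase i).equivFin ⟨v, hv⟩, by simp [c']⟩, by
      rintro ⟨k, rfl⟩
      exact ((C.erase i).equivFin.symm k).2⟩
  have hne : ∀ k, c' k ≠ i := fun k h => by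
    have := (hmem' i).2 ⟨k, h⟩
    simp at this
  let c : Fin ((C.erase i).card + 1) → V := Fin.cons i c'
  have hc : Function.Injective c := by
    refine Fin.cons_injective_iff.2 ⟨?_, hc'⟩
    rintro ⟨k, hk⟩
    exact hne k hk
  have hmem : ∀ v, v ∈ C ↔ ∃ k, c k = v := fun v => by
    rw [Fin.exists_fin_succ]
    simp only [c, Fin.cons_zero, Fin.cons_succ]
    rw [← hmem', Finset.mem_erase]
    constructor
    · intro hv
      by_cases h : i = v
      · exact .inl h
      · exact .inr ⟨fun h' => h h'.symm, hv⟩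
    · rintro (rfl | h)
      · exact hi
      · exact h.2
  have hC : G.genericMinor R C = (T.submatrix c c).det :=
    (Matrix.det_submatrix_of_image T C c hc hmem).symm
  have hC' : G.genericMinor R (C.erase i) = (T.submatrix c' c').det :=
    (Matrix.det_submatrix_of_image T _ c' hc' hmem').symm
  rw [hC, hC', Matrix.det_succ_row_zero, Fin.sum_univ_succ]
  -- With `i` placed first, the diagonal variable occurs only in the corner entry, so all further
  -- terms of the expansion are free of it.
  refine ⟨_, ?_, congrArg₂ (· + ·) ?_ rfl⟩
  · refine sum_mem fun k _ => mul_mem (mul_mem (pow_mem (neg_mem (one_mem _)) _) ?_)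
      (Matrix.det_mem_subalgebra _ fun a b => ?_)
    · exact G.genericPartialMatrix_mem_supported R fun h => hne k h.2
    · exact G.genericPartialMatrix_mem_supported R fun h => hne a h.1
  · have h1 : (T.submatrix c c).submatrix Fin.succ (Fin.succAbove 0) = T.submatrix c' c' := by
      ext a b
      simp [c]
    have h2 : T.submatrix c c 0 0 = X (G.loopAt i) := by
      simp only [Matrix.submatrix_apply, c, Fin.cons_zero]
      exact G.partialMatrix_apply _ (.inl rfl)
    rw [h1, h2]
    simp [mul_comm]

lemma genericMinor_empty : G.genericMinor R ∅ = 1 := Matrix.det_isEmpty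

variable {G} in
lemma IsClique.aeval_restrictMatrix_genericMinor {A : Type*} [CommRing A] [Algebra R A]
    {C : Finset V} (hC : G.IsClique (C : Set V)) (S : Matrix V V A) (hS : S.IsSymm) :
    aeval (G.restrictMatrix S hS) (G.genericMinor R C) =
      (S.submatrix (fun i : C => (i : V)) (fun j : C => (j : V))).det := by
  rw [aeval_genericMinor]
  congr 1
  ext a b
  exact G.partialMatrix_restrictMatrix S hS ((eq_or_ne (a : V) b).imp_right (hC a.2 b.2))

variable {G} in
/-- The generic symmetric determinant of a nonempty clique is irreducible. -/
lemma IsClique.irreducible_genericMinor (K : Type*) [Field K] (C : Finset V)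
    (hC : G.IsClique (C : Set V)) (hne : C.Nonempty) : Irreducible (G.genericMinor K C) := by
  induction C using Finset.strongInduction with
  | H C ih =>
  obtain ⟨i, hi⟩ := hne
  obtain ⟨s, hs, hdec⟩ := G.exists_genericMinor_eq K hi
  have hD := G.genericMinor_mem_supported K (Finset.notMem_erase i C)
  have hC' : G.IsClique ((C.erase i : Finset V) : Set V) :=
    hC.subset (Finset.coe_subset.2 (Finset.erase_subset i C))
  have hvars : ∀ {p}, p ∈ supported K ({G.loopAt i}ᶜ : Set G.LoopEdge) → G.loopAt i ∉ p.vars :=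
    fun hp h => (mem_supported.1 hp) h rfl
  rw [hdec]
  rcases (C.erase i).eq_empty_or_nonempty with h0 | hne'
  · rw [h0, G.genericMinor_empty K]
    refine irreducible_mul_X_add _ _ _ one_ne_zero (hvars (one_mem _)) (hvars hs) ?_
    exact isRelPrime_one_left
  have hirr := ih _ (Finset.erase_ssubset hi) hC' hne'
  refine irreducible_mul_X_add _ _ _ hirr.ne_zero (hvars hD) (hvars hs) ?_
  rw [hirr.isRelPrime_iff_not_dvd]
  intro hdvd
  have hdvd' : G.genericMinor K (C.erase i) ∣ G.genericMinor K C := by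
    rw [hdec]
    exact dvd_add (dvd_mul_right _ _) hdvd
  obtain ⟨j, hj⟩ := hne'
  have hjC := Finset.mem_of_mem_erase hj
  have hji := Finset.ne_of_mem_erase hj
  -- At the matrix of the transposition of `i` and `j` the minor of `C` is `-1`, while that of
  -- `C.erase i` has a zero row at `j`. So the leading coefficient does not divide the minor, nor
  -- the constant term `s`.
  let S : Matrix V V K := Matrix.of fun a b => if Equiv.swap i j a = b then 1 else 0
  have hS : S.IsSymm := Matrix.IsSymm.ext fun a b => by
    simp only [S, Matrix.of_apply]
    congr 1
    rw [eq_iff_iff, Equiv.swap_apply_eq_iff, eq_comm]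
  have hev := map_dvd (aeval (G.restrictMatrix S hS)) hdvd'
  rw [hC.aeval_restrictMatrix_genericMinor K, hC'.aeval_restrictMatrix_genericMinor K,
    Matrix.det_eq_zero_of_row_eq_zero ⟨j, hj⟩ (fun b => ?_), zero_dvd_iff] at hev
  · have hperm : S.submatrix (fun i : C => (i : V)) (fun j : C => (j : V)) =
        (Equiv.swap (⟨i, hi⟩ : C) ⟨j, hjC⟩).permMatrix K := by
      ext a b
      have hcoe : ((Equiv.swap (⟨i, hi⟩ : C) ⟨j, hjC⟩ a : C) : V) = Equiv.swap i j a := by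
        simp only [Equiv.swap_apply_def, Subtype.ext_iff]
        split_ifs <;> rfl
      simp only [S, Matrix.submatrix_apply, Matrix.of_apply, Equiv.Perm.permMatrix,
        PEquiv.toMatrix_apply, Equiv.toPEquiv_apply, Option.mem_some_iff, ← hcoe, Subtype.ext_iff]
    rw [hperm, Matrix.det_permutation] at hev
    rcases Int.units_eq_one_or (Equiv.Perm.sign (Equiv.swap (⟨i, hi⟩ : C) ⟨j, hjC⟩)) with h | h <;>
      simp [h] at hev
  · have : (b : V) ≠ i := Finset.ne_of_mem_erase b.2
    simp [S, this.symm]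

end SimpleGraph

/-! ### The boundary and the polynomials that vanish on it -/

section

open MvPolynomial Matrix Filter Topology

/-- A polynomial that vanishes at all real points near some point is zero. -/
lemma MvPolynomial.eq_zero_of_eventually_aeval {σ K : Type*} [Finite σ] [Field K] [Algebra ℝ K]
    (p : MvPolynomial σ K) (t : σ → ℝ)
    (h : ∀ᶠ x in 𝓝 t, aeval (fun e => algebraMap ℝ K (x e)) p = 0) : p = 0 := by
  cases nonempty_fintype σ
  obtain ⟨ε, hε, h⟩ := Metric.eventually_nhds_iff.1 h
  refine funext_set (fun e => algebraMap ℝ K '' Metric.ball (t e) ε) (fun e => ?_) fun x hx => ?_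
  · refine Set.Infinite.image (algebraMap ℝ K).injective.injOn ?_
    rw [Real.ball_eq_Ioo]
    exact Set.Ioo_infinite (by linarith)
  · choose y hy hyx using fun e => hx e (Set.mem_univ e)
    have := h ((dist_pi_lt_iff hε).2 hy)
    rw [_root_.funext hyx] at this
    exact this.trans (map_zero _).symm

lemma MvPolynomial.IsHomogeneous.eval_smul_vector {σ R : Type*} [CommRing R] {f : MvPolynomial σ R}
    {n : ℕ} (hf : f.IsHomogeneous n) (c : R) (x : σ → R) :
    eval (c • x) f = c ^ n * eval x f := by
  rw [eval_eq, eval_eq, Finset.mul_sum]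
  refine Finset.sum_congr rfl fun d hd => ?_
  have hdeg : d.degree = n := by
    rw [Finsupp.degree_eq_weight_one]
    exact hf (mem_support_iff.1 hd)
  simp only [Pi.smul_apply, smul_eq_mul, mul_pow, Finset.prod_mul_distrib,
    Finset.prod_pow_eq_pow_sum]
  rw [← hdeg, Finsupp.degree_apply]
  ring

lemma MvPolynomial.IsHomogeneous.mk_mem_projectiveZeroSet {σ : Type*} {f : MvPolynomial σ ℂ} {n : ℕ}
    (hf : f.IsHomogeneous n) {z : σ → ℂ} (hz : z ≠ 0) :
    Projectivization.mk ℂ z hz ∈ projectiveZeroSet f ↔ eval z f = 0 := by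
  obtain ⟨a, ha⟩ := Projectivization.exists_smul_eq_mk_rep ℂ z hz
  change eval (Projectivization.mk ℂ z hz).rep f = 0 ↔ _
  rw [← ha, Units.smul_def, hf.eval_smul_vector]
  simp

namespace SimpleGraph

variable {V : Type*} {G : SimpleGraph V}

lemma continuous_partialMatrix : Continuous fun t : G.LoopEdge → ℝ => G.partialMatrix t := by
  refine continuous_matrix fun i j => ?_
  simp only [partialMatrix, Matrix.of_apply]
  split_ifs with h
  · exact continuous_apply _
  · exact continuous_const

/-- Whether a minor over `K` vanishes at a real point can be decided over `ℝ`. -/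
lemma aeval_algebraMap_genericMinor [DecidableEq V] (K : Type*) [Field K] [Algebra ℝ K] (t : G.LoopEdge → ℝ)
    (C : Finset V) : aeval (fun e => algebraMap ℝ K (t e)) (G.genericMinor K C) =
      algebraMap ℝ K (aeval t (G.genericMinor ℝ C)) := by
  rw [aeval_genericMinor, aeval_genericMinor, RingHom.map_det, RingHom.mapMatrix_apply,
    ← Matrix.submatrix_map, map_partialMatrix]

variable [Fintype V]

lemma posDefOn_of_mem_sufficientStatisticsCone {T : G.LoopEdge → ℝ}
    (hT : T ∈ G.sufficientStatisticsCone) {C : Finset V} (hC : G.IsClique (C : Set V)) :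
    (G.partialMatrix T).PosDefOn C := by
  obtain ⟨S, hS, hST⟩ := hT
  have hpd : S.PosDefOn C := fun z _ hz0 => by simpa using hS.dotProduct_mulVec_pos hz0
  refine hpd.congr fun i hi j hj => ?_
  have h : s(i, j).IsDiag ∨ s(i, j) ∈ G.edgeSet := by
    simpa using (eq_or_ne i j).imp_right (hC hi hj)
  rw [hST i j h, partialMatrix_apply]

/-- A partial matrix with a chordal pattern has a positive definite completion as soon as its
clique blocks are positive definite. -/
lemma IsChordalGraph.mem_sufficientStatisticsCone (hG : G.IsChordalGraph) {T : G.LoopEdge → ℝ}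
    (hT : ∀ C : Finset V, G.IsClique (C : Set V) → (G.partialMatrix T).PosDefOn C) :
    T ∈ G.sufficientStatisticsCone := by
  obtain ⟨S, hS, -, hST, hSpd⟩ :=
    hG.exists_completion (G.partialMatrix_isSymm T) hT Finset.univ
  refine ⟨S, PosDef.of_dotProduct_mulVec_pos ?_ fun x hx => ?_, fun i j h => ?_⟩
  · rw [Matrix.IsHermitian, conjTranspose_eq_transpose_of_trivial]
    exact hS
  · simpa using hSpd x (by simp) hx
  · rw [hST i (Finset.mem_univ i) j (Finset.mem_univ j) (by simpa using h), partialMatrix_apply]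

lemma exists_maximalCliques_of_isClique {D : Finset V} (hD : G.IsClique (D : Set V)) :
    ∃ C ∈ G.maximalCliques, D ⊆ C := by
  obtain ⟨M, hDM, hM⟩ := (Set.toFinite {C : Set V | G.IsClique C}).exists_le_maximal hD
  classical
  obtain ⟨C, rfl⟩ : ∃ C : Finset V, (C : Set V) = M := ⟨_, M.coe_toFinset⟩
  exact ⟨C, mem_maximalCliques.2 hM, Finset.coe_subset.1 hDM⟩

lemma eq_of_mem_maximalCliques_of_subset {C D : Finset V} (hC : C ∈ G.maximalCliques)
    (hD : G.IsClique (D : Set V)) (h : C ⊆ D) : C = D :=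
  Finset.coe_injective ((mem_maximalCliques.1 hC).eq_of_le hD (Finset.coe_subset.2 h))

variable [DecidableEq V]

/-- On the boundary, the determinant of some maximal clique block vanishes. -/
lemma IsChordalGraph.exists_genericMinor_eq_zero (hG : G.IsChordalGraph) {T : G.LoopEdge → ℝ}
    (hT : T ∈ G.sufficientStatisticsBoundary) :
    ∃ C ∈ G.maximalCliques, aeval T (G.genericMinor ℝ C) = 0 := by
  by_contra! h
  refine hT.2 (hG.mem_sufficientStatisticsCone fun D hD => ?_)
  obtain ⟨C, hC, hDC⟩ := exists_maximalCliques_of_isClique hD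
  refine PosDefOn.mono ?_ hDC
  have hdet := h C hC
  rw [aeval_genericMinor] at hdet
  refine posDefOn_of_nonneg_of_det_ne_zero (G.partialMatrix_isSymm T) (fun z hz => ?_) hdet
  have hclosed : IsClosed {T : G.LoopEdge → ℝ | 0 ≤ z ⬝ᵥ G.partialMatrix T *ᵥ z} := by
    refine isClosed_le continuous_const ?_
    have := continuous_partialMatrix (G := G)
    fun_prop
  exact closure_minimal (fun T hT =>
    (posDefOn_of_mem_sufficientStatisticsCone hT (mem_maximalCliques.1 hC).prop).nonneg hz)
    hclosed hT.1

/-- If the block of a maximal clique `C` is singular, and the blocks of the cliques that do not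
contain `C` are positive definite, then the partial matrix lies on the boundary. -/
lemma IsChordalGraph.mem_sufficientStatisticsBoundary (hG : G.IsChordalGraph) {C : Finset V}
    (hC : C ∈ G.maximalCliques) {i : V} (hi : i ∈ C) {t : G.LoopEdge → ℝ}
    (hpd : ∀ D : Finset V, G.IsClique (D : Set V) → ¬ C ⊆ D → (G.partialMatrix t).PosDefOn D)
    (hdet : aeval t (G.genericMinor ℝ C) = 0) : t ∈ G.sufficientStatisticsBoundary := by
  have hCc : G.IsClique (C : Set V) := (mem_maximalCliques.1 hC).prop
  rw [aeval_genericMinor] at hdet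
  refine ⟨?_, fun h => (posDefOn_of_mem_sufficientStatisticsCone h hCc).det_ne_zero hdet⟩
  have hpsd : ∀ D : Finset V, G.IsClique (D : Set V) → ∀ z : V → ℝ, (∀ j ∉ D, z j = 0) →
      0 ≤ z ⬝ᵥ G.partialMatrix t *ᵥ z := fun D hD z hz => by
    by_cases hCD : C ⊆ D
    · obtain rfl := eq_of_mem_maximalCliques_of_subset hC hD hCD
      refine nonneg_of_posDefOn_erase (G.partialMatrix_isSymm t) (i := i)
        (hpd _ (hCc.subset (Finset.coe_subset.2 (Finset.erase_subset i C))) fun h => ?_) hdet hz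
      exact Finset.notMem_erase i C (h hi)
    · exact (hpd D hD hCD).nonneg hz
  -- Adding `ε` times the identity turns semidefinite clique blocks into definite ones, so the point
  -- is a limit of points of the cone.
  let d : G.LoopEdge → ℝ := G.restrictMatrix 1 Matrix.isSymm_one
  have hlim : Tendsto (fun ε : ℝ => t + ε • d) (𝓝[>] 0) (𝓝 t) := by
    have hc : Continuous fun ε : ℝ => t + ε • d := by fun_prop
    have := hc.tendsto 0
    rw [zero_smul, add_zero] at this
    exact this.mono_left nhdsWithin_le_nhds
  refine mem_closure_of_tendsto hlim ?_
  filter_upwards [self_mem_nhdsWithin] with ε hε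
  refine hG.mem_sufficientStatisticsCone fun D hD z hz hz0 => ?_
  have hentry : ∀ a ∈ D, ∀ b ∈ D, G.partialMatrix (t + ε • d) a b =
      (G.partialMatrix t + ε • (1 : Matrix V V ℝ)) a b := fun a ha b hb => by
    have hab : a = b ∨ G.Adj a b := (eq_or_ne a b).imp_right (hD ha hb)
    have h' : s(a, b).IsDiag ∨ s(a, b) ∈ G.edgeSet := by simpa using hab
    have h1 : G.partialMatrix d a b = _ := G.partialMatrix_restrictMatrix 1 Matrix.isSymm_one hab
    rw [Matrix.add_apply, Matrix.smul_apply, ← h1, partialMatrix_apply _ _ h',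
      partialMatrix_apply _ _ h', partialMatrix_apply _ _ h']
    rfl
  rw [dotProduct_mulVec_congr hentry hz, add_mulVec, smul_mulVec, one_mulVec, dotProduct_add,
    dotProduct_smul, smul_eq_mul]
  have h1 := hpsd D hD z hz
  have h2 : 0 < z ⬝ᵥ z := by simpa using dotProduct_star_self_pos_iff.2 hz0
  have h3 := mul_pos (Set.mem_Ioi.1 hε) h2
  linarith

/-- For each nonempty clique `C`, there is a partial matrix for which the block of `C` is singular
and the blocks of the cliques that do not contain `C` are positive definite. -/
lemma IsClique.exists_partialMatrix {C : Finset V} (hC : G.IsClique (C : Set V))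
    (hne : C.Nonempty) : ∃ t : G.LoopEdge → ℝ,
      (∀ D : Finset V, G.IsClique (D : Set V) → ¬ C ⊆ D → (G.partialMatrix t).PosDefOn D) ∧
        aeval t (G.genericMinor ℝ C) = 0 := by
  set χ : V → ℝ := fun i => if i ∈ C then 1 else 0 with hχ
  -- `χ` spans the kernel. If `D` does not contain `C`, Cauchy–Schwarz on `C ∩ D` bounds `(χ ⬝ᵥ z) ^
  -- 2` by `(C ∩ D).card * (z ⬝ᵥ z)`, and that cardinality is less than `C.card`.
  let S : Matrix V V ℝ := (C.card : ℝ) • (1 : Matrix V V ℝ) - vecMulVec χ χ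
  have hS : S.IsSymm := Matrix.IsSymm.ext fun i j => by
    simp only [S, Matrix.sub_apply, Matrix.smul_apply, vecMulVec_apply, Matrix.one_apply,
      eq_comm (a := i), mul_comm (χ i)]
  have hmul : ∀ z, S *ᵥ z = (C.card : ℝ) • z - (χ ⬝ᵥ z) • χ := fun z => by
    simp only [S, sub_mulVec, smul_mulVec, one_mulVec, vecMulVec_mulVec, op_smul_eq_smul]
  refine ⟨G.restrictMatrix S hS, fun D hD hCD z hz hz0 => ?_, ?_⟩
  · rw [dotProduct_mulVec_congr (N := S) (fun a ha b hb => G.partialMatrix_restrictMatrix S hS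
      ((eq_or_ne a b).imp_right (hD ha hb))) hz, hmul, dotProduct_sub, dotProduct_smul,
      dotProduct_smul, dotProduct_comm z χ, smul_eq_mul, smul_eq_mul]
    have h1 : χ ⬝ᵥ z = ∑ i ∈ C ∩ D, z i := by
      simp only [hχ, dotProduct, ite_mul, one_mul, zero_mul]
      rw [← Finset.sum_filter, Finset.filter_mem_eq_inter, Finset.univ_inter]
      refine (Finset.sum_subset Finset.inter_subset_left fun i hi hi' => hz i fun hD => ?_).symm
      exact hi' (Finset.mem_inter.2 ⟨hi, hD⟩)
    have h2 : (∑ i ∈ C ∩ D, z i) ^ 2 ≤ ((C ∩ D).card : ℝ) * ∑ i ∈ C ∩ D, z i ^ 2 :=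
      sq_sum_le_card_mul_sum_sq
    have h3 : ∑ i ∈ C ∩ D, z i ^ 2 ≤ z ⬝ᵥ z := by
      simp only [dotProduct, ← sq]
      exact Finset.sum_le_sum_of_subset_of_nonneg (Finset.subset_univ _) fun i _ _ => sq_nonneg _
    have h4 : ((C ∩ D).card : ℝ) + 1 ≤ C.card := by
      have : (C ∩ D).card < C.card := Finset.card_lt_card
        (Finset.ssubset_iff_subset_ne.2 ⟨Finset.inter_subset_left, fun h =>
          hCD (Finset.inter_eq_left.1 h)⟩)
      exact_mod_cast this
    have h5 : 0 < z ⬝ᵥ z := by simpa using dotProduct_star_self_pos_iff.2 hz0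
    have h6 : ((C ∩ D).card : ℝ) * ∑ i ∈ C ∩ D, z i ^ 2 ≤ ((C ∩ D).card : ℝ) * (z ⬝ᵥ z) :=
      mul_le_mul_of_nonneg_left h3 (Nat.cast_nonneg _)
    rw [h1]
    nlinarith [mul_le_mul_of_nonneg_right h4 h5.le]
  · rw [hC.aeval_restrictMatrix_genericMinor ℝ, det_submatrix_eq_zero_iff]
    refine ⟨χ, fun i hi => by simp [hχ, hi], fun h => ?_, fun j hj => ?_⟩
    · obtain ⟨i, hi⟩ := hne
      have := congrFun h i
      simp [hχ, hi] at this
    · rw [hmul]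
      have : χ ⬝ᵥ χ = C.card := by simp [hχ, dotProduct]
      simp [this, show χ j = 1 from if_pos hj]

/-- A polynomial that vanishes on the boundary is divisible by the minor of each maximal clique. -/
lemma IsChordalGraph.genericMinor_dvd (hG : G.IsChordalGraph) {K : Type*} [Field K] [Algebra ℝ K]
    {C : Finset V} (hC : C ∈ G.maximalCliques) {f : MvPolynomial G.LoopEdge K}
    (hf : ∀ t ∈ G.sufficientStatisticsBoundary, aeval (fun e => algebraMap ℝ K (t e)) f = 0) :
    G.genericMinor K C ∣ f := by
  have hCc : G.IsClique (C : Set V) := (mem_maximalCliques.1 hC).prop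
  rcases C.eq_empty_or_nonempty with rfl | hne
  · rw [genericMinor_empty]
    exact one_dvd f
  obtain ⟨i, hi⟩ := id hne
  obtain ⟨t, htpd, htdet⟩ := hCc.exists_partialMatrix hne
  -- The real expansion parametrises the hypersurface and the one over `K` serves the division; no
  -- relation between `r` and `s` is needed.
  obtain ⟨r, hr, hdecR⟩ := G.exists_genericMinor_eq ℝ hi
  obtain ⟨s, hs, hdecK⟩ := G.exists_genericMinor_eq K hi
  have hDR := G.genericMinor_mem_supported ℝ (Finset.notMem_erase i C)
  have hDK := G.genericMinor_mem_supported K (Finset.notMem_erase i C)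
  obtain ⟨N, q, g, hg, hdiv⟩ := exists_pow_mul_eq_mul_add _ hDK hs f
  rw [← hdecK] at hdiv
  have hsub : ¬ C ⊆ C.erase i := fun h => Finset.notMem_erase i C (h hi)
  have hDt : aeval t (G.genericMinor ℝ (C.erase i)) ≠ 0 := by
    rw [aeval_genericMinor]
    exact (htpd _ (hCc.subset (Finset.coe_subset.2 (Finset.erase_subset i C))) hsub).det_ne_zero
  have hcont : ∀ p : MvPolynomial G.LoopEdge ℝ, Continuous fun x => aeval x p := fun p => by
    exact p.continuous_eval
  -- Solves the vanishing of the minor of `C` for the diagonal entry at `i`; `φ` is the resulting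
  -- local projection onto the hypersurface, with `t` fixed.
  let y : (G.LoopEdge → ℝ) → ℝ := fun x => -(aeval x r) / aeval x (G.genericMinor ℝ (C.erase i))
  let φ : (G.LoopEdge → ℝ) → G.LoopEdge → ℝ := fun x => Function.update x (G.loopAt i) (y x)
  have hφt : φ t = t := by
    rw [Function.update_eq_self_iff]
    rw [hdecR, map_add, map_mul, aeval_X] at htdet
    simp only [y]
    rw [div_eq_iff hDt]
    linear_combination -htdet
  have hφc : Tendsto φ (𝓝 t) (𝓝 t) := by
    have hy : ContinuousAt y t :=
      (hcont r).continuousAt.neg.div (hcont _).continuousAt hDt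
    have : ContinuousAt φ t := continuousAt_id.update _ hy
    simpa only [ContinuousAt, hφt] using this
  have hev : ∀ᶠ x in 𝓝 t, φ x ∈ G.sufficientStatisticsBoundary ∧
      aeval (φ x) (G.genericMinor ℝ C) = 0 := by
    have h1 : ∀ᶠ x in 𝓝 t, ∀ D : Finset V, G.IsClique (D : Set V) → ¬ C ⊆ D →
        (G.partialMatrix (φ x)).PosDefOn D := by
      simp only [eventually_all]
      exact fun D hD hCD => ((continuous_partialMatrix.tendsto t).comp hφc).eventually
        (htpd D hD hCD).eventually
    have h2 := (hcont (G.genericMinor ℝ (C.erase i))).continuousAt.eventually_ne hDt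
    filter_upwards [h1, h2] with x hx1 hx2
    suffices h : aeval (φ x) (G.genericMinor ℝ C) = 0 from
      ⟨hG.mem_sufficientStatisticsBoundary hC hi hx1 h, h⟩
    have hupd : ∀ e ∈ ({G.loopAt i}ᶜ : Set G.LoopEdge), φ x e = x e := fun e he =>
      Function.update_of_ne he _ _
    rw [hdecR, map_add, map_mul, aeval_X, aeval_congr_of_supported hDR hupd,
      aeval_congr_of_supported hr hupd]
    simp only [φ, Function.update_self, y]
    field_simp
    ring
  -- The remainder does not involve the coordinate changed by `φ`, so it vanishes at all real points
  -- near `t`.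
  have hg0 : g = 0 := by
    refine eq_zero_of_eventually_aeval g t (hev.mono fun x ⟨hx, hP⟩ => ?_)
    have hupd : ∀ e ∈ ({G.loopAt i}ᶜ : Set G.LoopEdge),
        algebraMap ℝ K (x e) = algebraMap ℝ K (φ x e) := fun e he =>
      congrArg _ (Function.update_of_ne he _ _).symm
    have := congrArg (aeval fun e => algebraMap ℝ K (φ x e)) hdiv
    rw [map_mul, hf _ hx, map_add, map_mul, aeval_algebraMap_genericMinor, hP] at this
    rw [aeval_congr_of_supported hg hupd]
    simpa using this.symm
  rw [hg0, add_zero] at hdiv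
  have hprime : Prime (G.genericMinor K C) :=
    (hCc.irreducible_genericMinor K C hne).prime
  refine (hprime.dvd_or_dvd ⟨q, hdiv⟩).resolve_left fun h => ?_
  have h' := map_dvd (aeval fun e => algebraMap ℝ K (t e)) (hprime.dvd_of_dvd_pow h)
  rw [aeval_algebraMap_genericMinor, htdet, map_zero, zero_dvd_iff,
    aeval_algebraMap_genericMinor, map_eq_zero] at h'
  exact hDt h'

/-- The polynomials that vanish on the boundary are the multiples of the product of the minors of
the maximal cliques. -/
lemma IsChordalGraph.forall_aeval_eq_zero_iff (hG : G.IsChordalGraph) (K : Type*) [Field K]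
    [Algebra ℝ K] (f : MvPolynomial G.LoopEdge K) :
    (∀ t ∈ G.sufficientStatisticsBoundary, aeval (fun e => algebraMap ℝ K (t e)) f = 0) ↔
      G.maximalCliqueMinorProduct K ∣ f := by
  rw [maximalCliqueMinorProduct_eq]
  constructor
  · intro hf
    refine Finset.prod_dvd_of_isRelPrime (fun C hC D hD hCD => ?_)
      fun C hC => hG.genericMinor_dvd hC hf
    have hCc : G.IsClique (C : Set V) := (mem_maximalCliques.1 hC).prop
    have hDc : G.IsClique (D : Set V) := (mem_maximalCliques.1 hD).prop
    have hsub : ¬ C ⊆ D := fun h => hCD (eq_of_mem_maximalCliques_of_subset hC hDc h)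
    have hne : C.Nonempty := Finset.nonempty_iff_ne_empty.2 fun h => hsub (by simp [h])
    -- At this point the minor of `C` vanishes and that of `D` does not, which rules out
    -- divisibility.
    obtain ⟨t, htpd, htdet⟩ := hCc.exists_partialMatrix hne
    refine (hCc.irreducible_genericMinor K C hne).isRelPrime_iff_not_dvd.2 fun h => ?_
    have h' := map_dvd (aeval fun e => algebraMap ℝ K (t e)) h
    rw [aeval_algebraMap_genericMinor, htdet, map_zero, zero_dvd_iff,
      aeval_algebraMap_genericMinor, map_eq_zero, aeval_genericMinor] at h'
    exact (htpd D hDc hsub).det_ne_zero h'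
  · rintro ⟨q, rfl⟩ t ht
    obtain ⟨C, hC, h⟩ := hG.exists_genericMinor_eq_zero ht
    rw [map_mul, map_prod, Finset.prod_eq_zero hC, zero_mul]
    rw [aeval_algebraMap_genericMinor, h, map_zero]

variable (G) in
lemma exists_isHomogeneous_maximalCliqueMinorProduct (R : Type*) [CommRing R] :
    ∃ n, (G.maximalCliqueMinorProduct R).IsHomogeneous n := by
  rw [maximalCliqueMinorProduct_eq]
  refine ⟨_, IsHomogeneous.prod _ _ (fun C => C.card) fun C _ => ?_⟩
  rw [genericMinor, Matrix.det_apply]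
  refine IsHomogeneous.sum _ _ _ fun σ _ => ?_
  have h : (∏ a : C, (G.genericPartialMatrix R).submatrix (fun i : C => (i : V))
      (fun j : C => (j : V)) (σ a) a).IsHomogeneous (∑ _a : C, 1) := by
    refine IsHomogeneous.prod _ _ _ fun a _ => ?_
    simp only [genericPartialMatrix, Matrix.submatrix_apply, Matrix.of_apply]
    split_ifs
    · exact isHomogeneous_X _ _
    · exact isHomogeneous_zero _ _ _
  rw [Finset.sum_const, Finset.card_univ, Fintype.card_coe, smul_eq_mul, mul_one] at h
  rw [Units.smul_def]
  exact zsmul_mem (K := homogeneousSubmodule G.LoopEdge R C.card) h _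

end SimpleGraph

end

/-- For a chordal graph, the product `H` of the principal minors over all maximal cliques defines
the Zariski closure of the boundary of the cone of sufficient statistics: the ideal of all
polynomials that vanish on the boundary is generated by `H` (with real and with complex
coefficients), and the Zariski closure in complex projective space is the hypersurface `H = 0`. -/
theorem proposition4p1 {V : Type*} [Fintype V] (G : SimpleGraph V) (hG : G.IsChordalGraph) :
    MvPolynomial.vanishingIdeal ℝ G.sufficientStatisticsBoundary =
        Ideal.span {G.maximalCliqueMinorProduct ℝ} ∧
      MvPolynomial.vanishingIdeal ℂ (complexPoints G.sufficientStatisticsBoundary) =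
        Ideal.span {G.maximalCliqueMinorProduct ℂ} ∧
      projectiveZariskiClosure
          (projectivePoints (complexPoints G.sufficientStatisticsBoundary)) =
        projectiveZeroSet (G.maximalCliqueMinorProduct ℂ) := by
  classical
  refine ⟨?_, ?_, ?_⟩
  · ext f
    rw [Ideal.mem_span_singleton, ← hG.forall_aeval_eq_zero_iff ℝ f]
    rfl
  · ext f
    rw [Ideal.mem_span_singleton, ← hG.forall_aeval_eq_zero_iff ℂ f,
      MvPolynomial.mem_vanishingIdeal_iff, complexPoints, Set.forall_mem_image]
    rfl
  · obtain ⟨n, hn⟩ := G.exists_isHomogeneous_maximalCliqueMinorProduct ℂ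
    ext q
    refine ⟨fun hq => hq n _ hn ?_, fun hq m f hf hA => ?_⟩
    · rintro _ ⟨_, ⟨t, ht, rfl⟩, hz, rfl⟩
      rw [hn.mk_mem_projectiveZeroSet]
      exact (hG.forall_aeval_eq_zero_iff ℂ _).2 dvd_rfl t ht
    · obtain ⟨e, he⟩ := Function.ne_iff.1 q.rep_nonzero
      -- The origin may lie on the boundary but gives no projective point, so `f` need not vanish
      -- there. The factor `X e` takes care of the origin and is nonzero at `q`.
      have hdvd : G.maximalCliqueMinorProduct ℂ ∣ MvPolynomial.X e * f := by
        refine (hG.forall_aeval_eq_zero_iff ℂ _).1 fun t ht => ?_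
        rw [map_mul, MvPolynomial.aeval_X]
        by_cases hz : (fun e => (t e : ℂ)) = 0
        · have hze : algebraMap ℝ ℂ (t e) = 0 := congrFun hz e
          rw [hze, zero_mul]
        · have h0 := (hf.mk_mem_projectiveZeroSet hz).1 (hA ⟨_, ⟨t, ht, rfl⟩, hz, rfl⟩)
          refine mul_eq_zero_of_right _ ?_
          exact h0
      have h := map_dvd (MvPolynomial.eval q.rep) hdvd
      rw [show MvPolynomial.eval q.rep (G.maximalCliqueMinorProduct ℂ) = 0 from hq, zero_dvd_iff, map_mul,
        MvPolynomial.eval_X] at h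
      exact (mul_eq_zero.1 h).resolve_left he
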